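/- Let $A\in\mathbb R^{n\times n}$ be asymptotically stable (spectral radius $<1$), let $B\in\mathbb R^{n\times m}$, and suppose that the pair $(A,B)$ is reachable: every state of the system $X_{k+1}=AX_k+BW_k$ can be reached from the origin in finitely many steps by some input sequence. Let $R=\mathcal N(0,I_m)$ be the nominal law of each noise value, and let $t\geqslant n$ be a time horizon. For probability measures $\Phi,\Psi$ on $\mathbb R^n$ put $$J_t(\Phi,\Psi)=\inf\int_{\mathbb R^n} D\big(\kappa(\cdot\mid x)\,\big\|\,R^t\big)\,\Phi(dx),$$ where $D(\cdot\|\cdot)$ is the relative entropy (Kullback–Leibler divergence), $R^t=R\times\dots\times R$ ($t$ factors), and the infimum is over all conditional probability distributions $\kappa(\cdot\mid X_0)$ of $(W_0,\dots,W_{t-1})$ given $X_0$ such that $\kappa(\cdot\mid x)\ll R^t$ for $\Phi$-almost every $x$ and such that $X_0\sim\Phi$ implies $X_t\sim\Psi$. Let $\Phi=\mathcal N(\alpha,\Sigma)$ and $\Psi=\mathcal N(\beta,\Theta)$ with $\alpha,\beta\in\mathbb R^n$ and $\Sigma\succ0$, $\Theta\succ0$, and define $$\Gamma_t=\sum_{k=0}^{t-1}A^kBB^{\mathsf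 T}(A^k)^{\mathsf T},\qquad U=\Gamma_t^{-1/2}A^t\Sigma(A^t)^{\mathsf T}\Gamma_t^{-1/2},\qquad V=\Gamma_t^{-1/2}\Theta\,\Gamma_t^{-1/2}.$$ Then $\Gamma_t\succ0$, $U\succcurlyeq0$, $V\succ0$. The matrix $I_n+4UV$ is diagonalizable over $\mathbb R$ with nonnegative eigenvalues, so that it has a well-defined principal square root ($\sqrt{E\,\mathrm{diag}(\omega_k)E^{-1}}=E\,\mathrm{diag}(\sqrt{\omega_k})E^{-1}$). There is a real positive definite symmetric matrix $\mho$ with $$\mho+\mho U\mho=V,$$ and for every such $\mho$, with $\|v\|_M^2=v^{\mathsf T}Mv$, $$J_t(\Phi,\Psi)=\tfrac12\Big(\|\beta-A^t\alpha\|^2_{\Gamma_t^{-1}}+\operatorname{Tr}\big(U+V-\sqrt{I_n+4UV}\big)-\ln\det\mho\Big);$$ in particular $J_t(\Phi,\Psi)$ is finite. -/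

import Mathlib

open MeasureTheory ProbabilityTheory InformationTheory Matrix
open scoped ENNReal MatrixOrder

namespace NoiseSupply

noncomputable section

/-! ### Discrete-time systems driven by uncertain noise -/

section System

variable {X W : Type*}

/-- The `k` step state transition map `F_k` of the system `X_{k+1} = f(X_k, W_k)`:
`F_0(x) = x` and `F_{k+1}(x, w_0, …, w_k) = f(F_k(x, w_0, …, w_{k-1}), w_k)`. -/
def transitionMap (f : X → W → X) : (k : ℕ) → X → (Fin k → W) → X
  | 0, x, _ => x
  | k + 1, x, w => f (transitionMap f k x (fun i => w i.castSucc)) (w (Fin.last k))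

variable [MeasurableSpace X] [MeasurableSpace W]

/-- The product measure `R^t`: under the nominal model the noise values `W_0, …, W_{t-1}` are
independent with law `R`, and independent of the initial state. -/
def nominalNoise (R : Measure W) (t : ℕ) : Measure (Fin t → W) :=
  Measure.pi (fun _ => R)

/-- The law `P_t` of the state `X_t` when `X_0` has law `Φ` and `κ` is the conditional law of the
noise sequence `(W_0, …, W_{t-1})` given `X_0`, so that `(X_0, W_0, …, W_{t-1})` has law `Φ ⊗ₘ κ`. -/
def terminalLaw (f : X → W → X) (t : ℕ) (Φ : Measure X) (κ : Kernel X (Fin t → W)) : Measure X :=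
  (Φ ⊗ₘ κ).map (fun y => transitionMap f t y.1 y.2)

/-- The conditional relative entropy supply `E_{0,t} = ∫ D₀(P_{W_{0:t-1} | X_0 = x} ‖ R^t) Φ(dx)`,
where `D₀` is the relative entropy (Kullback-Leibler divergence). -/
def supply (R : Measure W) (t : ℕ) (Φ : Measure X) (κ : Kernel X (Fin t → W)) : ℝ≥0∞ :=
  ∫⁻ x, klDiv (κ x) (nominalNoise R t) ∂Φ

/-- A noise strategy on the time interval `[0, t)` (a regular conditional law `κ` of
`(W_0, …, W_{t-1})` given `X_0`) which is absolutely continuous with respect to `R^t` for `Φ`-almost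
all initial states and which drives the state law from `P_0 = Φ` to `P_t = Ψ`. -/
structure IsDrivingStrategy (f : X → W → X) (R : Measure W) (t : ℕ) (Φ Ψ : Measure X)
    (κ : Kernel X (Fin t → W)) : Prop where
  isMarkovKernel : IsMarkovKernel κ
  absolutelyContinuous : ∀ᵐ x ∂Φ, κ x ≪ nominalNoise R t
  terminalLaw_eq : terminalLaw f t Φ κ = Ψ

/-- The minimum required conditional relative entropy supply `J_t(Φ, Ψ)`, with the value `∞` if no
strategy drives `Φ` to `Ψ`. -/
def minSupply (f : X → W → X) (R : Measure W) (t : ℕ) (Φ Ψ : Measure X) : ℝ≥0∞ :=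
  sInf {E | ∃ κ : Kernel X (Fin t → W), IsDrivingStrategy f R t Φ Ψ κ ∧ E = supply R t Φ κ}

end System

/-! ### Linear systems -/

section Linear

variable {n m : ℕ}

/-- The one-step transition map `f(x, w) = A x + B w`. -/
def linearStep (A : Matrix (Fin n) (Fin n) ℝ) (B : Matrix (Fin n) (Fin m) ℝ)
    (x : EuclideanSpace ℝ (Fin n)) (w : EuclideanSpace ℝ (Fin m)) : EuclideanSpace ℝ (Fin n) :=
  WithLp.toLp 2 (A *ᵥ x.ofLp + B *ᵥ w.ofLp)

/-- `A` is asymptotically stable: its spectral radius (the largest modulus of its complex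
eigenvalues) is less than one. -/
def IsAsymptoticallyStable (A : Matrix (Fin n) (Fin n) ℝ) : Prop :=
  spectralRadius ℂ (A.map (algebraMap ℝ ℂ)) < 1

/-- `(A, B)` is reachable: every state can be reached from the origin in finitely many steps by
some input sequence. -/
def IsReachable (A : Matrix (Fin n) (Fin n) ℝ) (B : Matrix (Fin n) (Fin m) ℝ) : Prop :=
  ∀ x : EuclideanSpace ℝ (Fin n), ∃ (k : ℕ) (u : Fin k → EuclideanSpace ℝ (Fin m)),
    transitionMap (linearStep A B) k 0 u = x

/-- The finite-horizon reachability Gramian `Γ_t = ∑_{k<t} A^k B Bᵀ (A^k)ᵀ`. -/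
def gramian (A : Matrix (Fin n) (Fin n) ℝ) (B : Matrix (Fin n) (Fin m) ℝ) (t : ℕ) :
    Matrix (Fin n) (Fin n) ℝ :=
  ∑ k ∈ Finset.range t, A ^ k * B * Bᵀ * (A ^ k)ᵀ

/-- `Γ_t^{-1/2}`, the inverse of the positive semidefinite square root of `Γ_t`. -/
def gramianInvSqrt (A : Matrix (Fin n) (Fin n) ℝ) (B : Matrix (Fin n) (Fin m) ℝ) (t : ℕ) :
    Matrix (Fin n) (Fin n) ℝ :=
  (CFC.sqrt (gramian A B t))⁻¹

/-- `U = Γ_t^{-1/2} A^t S (A^t)ᵀ Γ_t^{-1/2}` for the initial covariance matrix `S`. -/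
def matU (A : Matrix (Fin n) (Fin n) ℝ) (B : Matrix (Fin n) (Fin m) ℝ) (t : ℕ)
    (S : Matrix (Fin n) (Fin n) ℝ) : Matrix (Fin n) (Fin n) ℝ :=
  gramianInvSqrt A B t * A ^ t * S * (A ^ t)ᵀ * gramianInvSqrt A B t

/-- `V = Γ_t^{-1/2} Θ Γ_t^{-1/2}` for the terminal covariance matrix `Θ`. -/
def matV (A : Matrix (Fin n) (Fin n) ℝ) (B : Matrix (Fin n) (Fin m) ℝ) (t : ℕ)
    (Θ : Matrix (Fin n) (Fin n) ℝ) : Matrix (Fin n) (Fin n) ℝ :=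
  gramianInvSqrt A B t * Θ * gramianInvSqrt A B t

/-- The weighted squared norm `‖v‖_M² = vᵀ M v`. -/
def weightedNormSq (M : Matrix (Fin n) (Fin n) ℝ) (v : Fin n → ℝ) : ℝ :=
  v ⬝ᵥ (M *ᵥ v)

end Linear

/-! ### Square roots of (not necessarily symmetric) diagonalizable matrices -/

section Sqrt

variable {n : ℕ}

/-- `T` is the principal square root of `M`: `M = E diag(ω) E⁻¹` is diagonalizable over `ℝ` with
eigenvalues `ω_i ≥ 0`, and `T = E diag(√ω) E⁻¹`. -/
def IsPrincipalSqrt (M T : Matrix (Fin n) (Fin n) ℝ) : Prop :=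
  ∃ (E : Matrix (Fin n) (Fin n) ℝ) (ω : Fin n → ℝ), IsUnit E.det ∧ (∀ i, 0 ≤ ω i) ∧
    M = E * diagonal ω * E⁻¹ ∧ T = E * diagonal (fun i => √(ω i)) * E⁻¹

/-- The principal square root does not depend on the diagonalization. -/
theorem IsPrincipalSqrt.unique {M T T' : Matrix (Fin n) (Fin n) ℝ} (h : IsPrincipalSqrt M T)
    (h' : IsPrincipalSqrt M T') : T = T' := by
  obtain ⟨E, ω, hE, -, hM, rfl⟩ := h
  obtain ⟨F, ν, hF, -, hM', rfl⟩ := h'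
  have h1 : diagonal ω * (E⁻¹ * F) = (E⁻¹ * F) * diagonal ν := by
    have h0 : E⁻¹ * (E * diagonal ω * E⁻¹) * F = E⁻¹ * (F * diagonal ν * F⁻¹) * F := by
      rw [← hM, ← hM']
    simpa [Matrix.mul_assoc, Matrix.nonsing_inv_mul_cancel_left _ _ hE,
      Matrix.nonsing_inv_mul _ hF] using h0
  have h2 : diagonal (fun i => √(ω i)) * (E⁻¹ * F) =
      (E⁻¹ * F) * diagonal (fun i => √(ν i)) := by
    ext i j
    have hij := congrFun (congrFun h1 i) j
    rw [diagonal_mul, mul_diagonal] at hij ⊢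
    by_cases hc : (E⁻¹ * F) i j = 0
    · simp [hc]
    · have : ω i = ν j := by
        apply mul_right_cancel₀ hc
        rw [hij, mul_comm]
      rw [this, mul_comm]
  calc E * diagonal (fun i => √(ω i)) * E⁻¹
      = E * (diagonal (fun i => √(ω i)) * (E⁻¹ * F)) * F⁻¹ := by
        simp [Matrix.mul_assoc, Matrix.mul_nonsing_inv _ hF]
    _ = F * diagonal (fun i => √(ν i)) * F⁻¹ := by
        rw [h2]
        simp [Matrix.mul_assoc, Matrix.mul_nonsing_inv_cancel_left _ _ hE]

open Classical in
/-- The principal square root of a matrix that has one (zero by convention otherwise). -/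
def principalSqrt (M : Matrix (Fin n) (Fin n) ℝ) : Matrix (Fin n) (Fin n) ℝ :=
  if h : ∃ T, IsPrincipalSqrt M T then h.choose else 0

theorem IsPrincipalSqrt.eq {M T : Matrix (Fin n) (Fin n) ℝ} (h : IsPrincipalSqrt M T) :
    principalSqrt M = T := by
  have hex : ∃ T, IsPrincipalSqrt M T := ⟨T, h⟩
  rw [principalSqrt, dif_pos hex]
  exact hex.choose_spec.unique h

end Sqrt

end

end NoiseSupply

namespace NoiseSupply

/-! ### Linear systems: closed form of the transition map and positivity of the Gramian -/

section Reachability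

variable {n m : ℕ}

/-! The proof is convex duality, with a quadratic potential certifying optimality. Let `F(x, w)` be
the state at time `t`. For any function `g` of the terminal state, the Gibbs inequality bounds
`D(κ(·|x) ‖ R^t)` below by `∫ g(F(x, w)) κ(dw|x) - ℓ(x)`, where `ℓ(x) = ln ∫ exp g(F(x, w))
R^t(dw)`. Averaged over `Φ`, the first term becomes `∫ g dΨ` for every driving strategy, so the
supply is at least `∫ g dΨ - ∫ ℓ dΦ` (`le_supply_of_potential`). Tilting `R^t` by `g(F(x, ·))` turns
the inequality into an equality (`supply_eq_of_tilted`). It therefore suffices to find one `g` whose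
tilted strategy drives `Φ` to `Ψ`.

Under nominal noise `F(x, ·)` has law `N(A^t x, Γ)`, and tilting by a quadratic `g` with Hessian
`Γ⁻¹ - P⁻¹` and linear part `h` gives `N(P(Γ⁻¹ A^t x + h), P)`. Mixing over `Φ` keeps the law
Gaussian. The vector `h` adjusts the mean, and the covariance condition is `P + P Γ⁻¹ A^t Σ (A^t)ᵀ
Γ⁻¹ P = Θ`. With `P = Γ^{1/2} G Γ^{1/2}` this is `G + G U G = V`, and Gaussian moments then give the
dual value (`minSupply_multivariateGaussian`).

The square root enters through `(1 + 2UG)² = 1 + 4U(G + GUG) = 1 + 4UV`: since `UG` is similar to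
the positive semidefinite `G^{1/2} U G^{1/2}`, the matrix `1 + 2UG` is the principal root. -/

theorem transitionMap_linearStep (A : Matrix (Fin n) (Fin n) ℝ) (B : Matrix (Fin n) (Fin m) ℝ)
    (t : ℕ) (x : EuclideanSpace ℝ (Fin n)) (w : Fin t → EuclideanSpace ℝ (Fin m)) :
    transitionMap (linearStep A B) t x w =
      WithLp.toLp 2 (A ^ t *ᵥ x.ofLp + ∑ k : Fin t, (A ^ (t - 1 - k) * B) *ᵥ (w k).ofLp) := by
  induction t with
  | zero => simp [transitionMap]
  | succ t ih =>
    simp only [transitionMap, linearStep, ih, Fin.sum_univ_castSucc, mulVec_add, mulVec_sum,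
      mulVec_mulVec]
    congr 1
    rw [← pow_succ', add_assoc]
    congr 2
    · refine Finset.sum_congr rfl fun k _ => ?_
      rw [← Matrix.mul_assoc, ← pow_succ', Fin.val_castSucc]
      congr 3
      have := k.2
      omega
    · simp

/-- By Cayley–Hamilton, `A ^ k` is a polynomial in `A` of degree below `n`. -/
theorem vecMul_pow_mul_eq_zero {A : Matrix (Fin n) (Fin n) ℝ} {B : Matrix (Fin n) (Fin m) ℝ}
    {x : Fin n → ℝ} (h : ∀ k < n, x ᵥ* (A ^ k * B) = 0) (k : ℕ) : x ᵥ* (A ^ k * B) = 0 := by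
  rcases Nat.eq_zero_or_pos n with rfl | hn
  · ext j
    simp [Subsingleton.elim x 0]
  -- The strict bound fails for `n = 0`, where the characteristic polynomial is `1`; hence the case
  -- split.
  have hdeg : (Polynomial.X ^ k %ₘ A.charpoly).natDegree < n := by
    have h1 : A.charpoly.natDegree = n := by simp
    have h2 := Polynomial.natDegree_modByMonic_lt (Polynomial.X ^ k) A.charpoly_monic (by
      intro hc
      rw [hc] at h1
      simp at h1
      omega)
    omega
  rw [pow_eq_aeval_mod_charpoly, Polynomial.aeval_eq_sum_range' hdeg, Matrix.sum_mul,
    vecMul_sum]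
  refine Finset.sum_eq_zero fun i hi => ?_
  rw [Matrix.smul_mul, vecMul_smul, h i (Finset.mem_range.1 hi), smul_zero]

theorem dotProduct_gramian_mulVec (A : Matrix (Fin n) (Fin n) ℝ) (B : Matrix (Fin n) (Fin m) ℝ)
    (t : ℕ) (x : Fin n → ℝ) :
    x ⬝ᵥ (gramian A B t *ᵥ x) =
      ∑ k ∈ Finset.range t, (x ᵥ* (A ^ k * B)) ⬝ᵥ (x ᵥ* (A ^ k * B)) := by
  rw [gramian, sum_mulVec, dotProduct_sum]
  refine Finset.sum_congr rfl fun k _ => ?_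
  rw [show A ^ k * B * Bᵀ * (A ^ k)ᵀ = (A ^ k * B) * (A ^ k * B)ᵀ by
    rw [transpose_mul, Matrix.mul_assoc], ← mulVec_mulVec, dotProduct_mulVec, mulVec_transpose]

theorem isSymm_gramian (A : Matrix (Fin n) (Fin n) ℝ) (B : Matrix (Fin n) (Fin m) ℝ)
    (t : ℕ) : (gramian A B t)ᵀ = gramian A B t := by
  simp [gramian, transpose_sum, Matrix.mul_assoc]

/-- If the quadratic form vanishes at `x`, then `x` annihilates `A ^ k * B` for `k < t`, hence for
all `k` because `n ≤ t`. So `x` is orthogonal to every reachable state, and in particular to itself.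
-/
theorem posDef_gramian {A : Matrix (Fin n) (Fin n) ℝ} {B : Matrix (Fin n) (Fin m) ℝ}
    (hAB : IsReachable A B) {t : ℕ} (ht : n ≤ t) : (gramian A B t).PosDef := by
  refine PosDef.of_dotProduct_mulVec_pos ?_ fun x hx => ?_
  · rw [IsHermitian, conjTranspose_eq_transpose_of_trivial, isSymm_gramian]
  rw [star_trivial, dotProduct_gramian_mulVec]
  have hnn : ∀ k ∈ Finset.range t, 0 ≤ (x ᵥ* (A ^ k * B)) ⬝ᵥ (x ᵥ* (A ^ k * B)) :=
    fun k _ => Finset.sum_nonneg fun i _ => mul_self_nonneg _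
  refine lt_of_le_of_ne (Finset.sum_nonneg hnn) fun h0 => hx ?_
  have hz := (Finset.sum_eq_zero_iff_of_nonneg hnn).1 h0.symm
  have hz' := vecMul_pow_mul_eq_zero (A := A) (B := B) (x := x) fun k hk =>
    dotProduct_self_eq_zero.1 (hz k (Finset.mem_range.2 (hk.trans_le ht)))
  obtain ⟨k, u, hu⟩ := hAB (WithLp.toLp 2 x)
  rw [transitionMap_linearStep] at hu
  have hu' := congrArg (fun y => x ⬝ᵥ y.ofLp) hu
  simp only [WithLp.ofLp_zero, mulVec_zero, zero_add, dotProduct_sum, dotProduct_mulVec, hz',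
    zero_dotProduct, Finset.sum_const_zero] at hu'
  exact dotProduct_self_eq_zero.1 hu'.symm

end Reachability

/-! ### The quadratic matrix equation `G + G U G = V` -/

section MatrixEquation

variable {n : ℕ}

theorem isPrincipalSqrt_of_similar_diagonal {M T E : Matrix (Fin n) (Fin n) ℝ} {d : Fin n → ℝ}
    (hE : IsUnit E.det) (hd : ∀ i, 0 ≤ d i) (hT : T = E * diagonal d * E⁻¹) (hM : M = T * T) :
    IsPrincipalSqrt M T := by
  refine ⟨E, fun i => d i * d i, hE, fun i => mul_self_nonneg _, ?_, ?_⟩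
  · rw [hM, hT, ← diagonal_mul_diagonal]
    simp only [Matrix.mul_assoc, Matrix.nonsing_inv_mul_cancel_left _ _ hE]
  · simp only [Real.sqrt_mul_self (hd _), hT]

theorem exists_orthogonal_diagonalization {M : Matrix (Fin n) (Fin n) ℝ} (hM : M.PosSemidef) :
    ∃ (O : Matrix (Fin n) (Fin n) ℝ) (d : Fin n → ℝ), Oᵀ * O = 1 ∧ O * Oᵀ = 1 ∧ (∀ i, 0 ≤ d i) ∧
      M = O * diagonal d * Oᵀ := by
  refine ⟨hM.1.eigenvectorUnitary, hM.1.eigenvalues, ?_, ?_, hM.eigenvalues_nonneg, ?_⟩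
  · simpa [star_eq_conjTranspose] using Unitary.coe_star_mul_self hM.1.eigenvectorUnitary
  · simpa [star_eq_conjTranspose] using Unitary.coe_mul_star_self hM.1.eigenvectorUnitary
  · have := hM.1.spectral_theorem
    rw [Unitary.conjStarAlgAut_apply] at this
    simpa [star_eq_conjTranspose, Function.comp_def] using this

theorem posDef_sqrt_and_mul_self {G : Matrix (Fin n) (Fin n) ℝ} (hG : G.PosDef) :
    (CFC.sqrt G).PosDef ∧ (CFC.sqrt G)ᵀ = CFC.sqrt G ∧ CFC.sqrt G * CFC.sqrt G = G := by
  have hsq : CFC.sqrt G * CFC.sqrt G = G := CFC.sqrt_mul_sqrt_self G hG.posSemidef.nonneg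
  have hps : (CFC.sqrt G).PosSemidef := nonneg_iff_posSemidef.1 (CFC.sqrt_nonneg G)
  have hpd : (CFC.sqrt G).PosDef := by
    rw [hps.posDef_iff_det_ne_zero]
    intro h0
    have := hG.det_pos
    rw [← hsq, det_mul, h0] at this
    simp at this
  refine ⟨hpd, ?_, hsq⟩
  have := hps.1
  rwa [IsHermitian, conjTranspose_eq_transpose_of_trivial] at this

/-- With `K = G^{1/2}`, `U * G = K⁻¹ (K U K) K`, so an orthogonal diagonalization of `K U K`
diagonalizes `1 + 2UG` with eigenvalues at least `1`. Its square is `1 + 4UV` by the quadratic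
equation. -/
theorem isPrincipalSqrt_of_quadratic {U V G : Matrix (Fin n) (Fin n) ℝ} (hU : U.PosSemidef)
    (hG : G.PosDef) (h : G + G * U * G = V) :
    IsPrincipalSqrt (1 + (4 : ℝ) • (U * V)) (1 + (2 : ℝ) • (U * G)) := by
  obtain ⟨hKpd, hKt, hKK⟩ := posDef_sqrt_and_mul_self hG
  set K := CFC.sqrt G
  have hKu : IsUnit K.det := hKpd.det_pos.ne'.isUnit
  have hM : (K * U * K).PosSemidef := by
    simpa [conjTranspose_eq_transpose_of_trivial, hKt] using hU.mul_mul_conjTranspose_same K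
  obtain ⟨O, d, hO, hO', hd, hMd⟩ := exists_orthogonal_diagonalization hM
  have hOinv : O⁻¹ = Oᵀ := inv_eq_left_inv hO
  have hOu : IsUnit O.det := (isUnit_iff_isUnit_det O).1 ⟨⟨O, Oᵀ, hO', hO⟩, rfl⟩
  have hUG : U * G = K⁻¹ * O * diagonal d * (K⁻¹ * O)⁻¹ := by
    rw [Matrix.mul_inv_rev, hOinv, nonsing_inv_nonsing_inv _ hKu]
    calc U * G = U * (K * K) := by rw [hKK]
      _ = K⁻¹ * (K * U * K) * K := by
        simp [Matrix.mul_assoc, Matrix.nonsing_inv_mul_cancel_left _ _ hKu]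
      _ = _ := by rw [hMd]; simp [Matrix.mul_assoc]
  have hEu : IsUnit (K⁻¹ * O).det := by
    rw [det_mul]
    exact (isUnit_nonsing_inv_det _ hKu).mul hOu
  refine isPrincipalSqrt_of_similar_diagonal (E := K⁻¹ * O) (d := fun i => 1 + 2 * d i) hEu
    (fun i => by have := hd i; positivity) ?_ ?_
  · have : diagonal (fun i => 1 + 2 * d i) = 1 + (2 : ℝ) • diagonal d := by
      ext i j
      by_cases hij : i = j <;> simp [hij]
    rw [this, Matrix.mul_add, Matrix.add_mul, Matrix.mul_one, Matrix.mul_nonsing_inv _ hEu, hUG,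
      Matrix.mul_smul, Matrix.smul_mul]
  · rw [← h]
    simp only [Matrix.mul_add, Matrix.add_mul, Matrix.mul_one, Matrix.one_mul, Matrix.smul_mul,
      Matrix.mul_smul, Matrix.mul_assoc]
    module

/-- Substituting `G = K X K` with `K = V^{1/2}` reduces the equation to `X + X M X = 1` for `M = K U
K`, which is solved on the eigenvalues of `M`. -/
theorem exists_posDef_quadratic {U V : Matrix (Fin n) (Fin n) ℝ} (hU : U.PosSemidef)
    (hV : V.PosDef) : ∃ G : Matrix (Fin n) (Fin n) ℝ, G.PosDef ∧ G + G * U * G = V := by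
  obtain ⟨hKpd, hKt, hKK⟩ := posDef_sqrt_and_mul_self hV
  set K := CFC.sqrt V
  have hKu : IsUnit K.det := hKpd.det_pos.ne'.isUnit
  have hM : (K * U * K).PosSemidef := by
    simpa [conjTranspose_eq_transpose_of_trivial, hKt] using hU.mul_mul_conjTranspose_same K
  obtain ⟨O, d, hO, hO', hd, hMd⟩ := exists_orthogonal_diagonalization hM
  have hs : ∀ i, 0 < 1 + √(1 + 4 * d i) := fun i => by positivity
  -- The positive root of `q + d q² = 1`, in the rationalized form that remains valid at `d = 0`.
  set q : Fin n → ℝ := fun i => 2 / (1 + √(1 + 4 * d i)) with hq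
  have hq0 : ∀ i, 0 < q i := fun i => div_pos two_pos (hs i)
  have hqd : diagonal q + diagonal q * diagonal d * diagonal q = 1 := by
    rw [diagonal_mul_diagonal, diagonal_mul_diagonal, diagonal_add, ← diagonal_one]
    congr 1
    ext i
    have h1 := Real.sq_sqrt (show 0 ≤ 1 + 4 * d i by have := hd i; positivity)
    have h2 := (hs i).ne'
    simp only [hq]
    field_simp
    nlinarith
  refine ⟨K * (O * diagonal q * Oᵀ) * K, ?_, ?_⟩
  · have h1 : (diagonal q).PosDef := PosDef.diagonal hq0
    have h2 := h1.mul_mul_conjTranspose_same (B := K * O) (by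
      refine vecMul_injective_iff_isUnit.2 ((isUnit_iff_isUnit_det _).2 ?_)
      rw [det_mul]
      exact hKu.mul ((isUnit_iff_isUnit_det O).1 ⟨⟨O, Oᵀ, hO', hO⟩, rfl⟩))
    rw [conjTranspose_eq_transpose_of_trivial, transpose_mul, hKt] at h2
    convert! h2 using 1
    simp [Matrix.mul_assoc]
  · have e1 : ∀ X : Matrix (Fin n) (Fin n) ℝ, Oᵀ * (O * X) = X := fun X => by
      rw [← Matrix.mul_assoc, hO, Matrix.one_mul]
    calc K * (O * diagonal q * Oᵀ) * K +
          K * (O * diagonal q * Oᵀ) * K * U * (K * (O * diagonal q * Oᵀ) * K)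
        = K * (O * diagonal q * Oᵀ) * K +
          K * (O * diagonal q * Oᵀ) * (K * U * K) * (O * diagonal q * Oᵀ) * K := by
          simp only [Matrix.mul_assoc]
      _ = K * O * (diagonal q + diagonal q * diagonal d * diagonal q) * Oᵀ * K := by
          rw [hMd]
          simp only [Matrix.mul_assoc, Matrix.mul_add, Matrix.add_mul, e1]
      _ = V := by
          rw [hqd, Matrix.mul_one, Matrix.mul_assoc K, hO', Matrix.mul_one, hKK]

end MatrixEquation

/-! ### Density and exponential tilting of the multivariate Gaussian law -/

section Gaussian

variable {n : ℕ}

open scoped RealInnerProductSpace in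
-- Characteristic functions are compared using the Fourier transform of `exp(-‖v‖²/2)`. The constant
-- need not be evaluated, since only ratios of Gaussian densities occur later.
theorem exists_stdGaussian_eq_withDensity (n : ℕ) : ∃ c : ℝ, 0 < c ∧
    stdGaussian (EuclideanSpace ℝ (Fin n)) =
      (volume : Measure (EuclideanSpace ℝ (Fin n))).withDensity
        (fun v => ENNReal.ofReal (c * Real.exp (-(1 / 2) * ‖v‖ ^ 2))) := by
  have hint : Integrable (fun v : EuclideanSpace ℝ (Fin n) => Real.exp (-(1 / 2) * ‖v‖ ^ 2)) := by
    have h := (GaussianFourier.integrable_cexp_neg_mul_sq_norm_add (V := EuclideanSpace ℝ (Fin n))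
      (b := ((1 / 2 : ℝ) : ℂ)) (by norm_num) 0 0).re
    refine h.congr (Filter.Eventually.of_forall fun v => ?_)
    have : Complex.exp (-((1 / 2 : ℝ) : ℂ) * (‖v‖ : ℂ) ^ 2 + 0 * ((⟪0, v⟫ : ℝ) : ℂ)) =
        ((Real.exp (-(1 / 2) * ‖v‖ ^ 2) : ℝ) : ℂ) := by
      push_cast
      simp
    simp only [this]
    exact Complex.ofReal_re _
  set I₀ : ℝ := ∫ v : EuclideanSpace ℝ (Fin n), Real.exp (-(1 / 2) * ‖v‖ ^ 2) with hI₀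
  have hI : 0 < I₀ := integral_exp_pos hint
  have key (t : EuclideanSpace ℝ (Fin n)) : ∫ v : EuclideanSpace ℝ (Fin n),
      Complex.exp (-((1 / 2 : ℝ) : ℂ) * (‖v‖ : ℂ) ^ 2 + Complex.I * ((⟪t, v⟫ : ℝ) : ℂ)) =
        I₀ * Complex.exp (-‖t‖ ^ 2 / 2) := by
    have h0 : (I₀ : ℂ) = ∫ v : EuclideanSpace ℝ (Fin n),
        Complex.exp (-((1 / 2 : ℝ) : ℂ) * (‖v‖ : ℂ) ^ 2) := by
      rw [hI₀, ← integral_complex_ofReal]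
      refine integral_congr_ae (Filter.Eventually.of_forall fun v => ?_)
      push_cast
      simp
    rw [h0, GaussianFourier.integral_cexp_neg_mul_sq_norm (by norm_num),
      GaussianFourier.integral_cexp_neg_mul_sq_norm_add (by norm_num)]
    congr 2
    rw [Complex.I_sq]
    push_cast
    ring
  refine ⟨I₀⁻¹, inv_pos.2 hI, ?_⟩
  have hint' := hint.const_mul I₀⁻¹
  have := isFiniteMeasure_withDensity_ofReal hint'.2
  refine Measure.ext_of_charFun (funext fun t => ?_)
  rw [charFun_stdGaussian, charFun_apply, integral_withDensity_eq_integral_toReal_smul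
    (by fun_prop) (by simp)]
  have hI' : (I₀ : ℂ) ≠ 0 := by exact_mod_cast hI.ne'
  rw [← mul_right_inj' hI', ← key t, ← integral_const_mul]
  refine integral_congr_ae (Filter.Eventually.of_forall fun v => ?_)
  simp only
  rw [ENNReal.toReal_ofReal (by positivity), Complex.exp_add, real_inner_comm t v,
    mul_comm Complex.I, Complex.real_smul]
  push_cast
  rw [← mul_assoc, mul_inv_cancel_left₀ hI']

theorem lintegral_comp_affine {K : Matrix (Fin n) (Fin n) ℝ} (hK : K.det ≠ 0)
    (m : EuclideanSpace ℝ (Fin n)) {f : EuclideanSpace ℝ (Fin n) → ℝ≥0∞} (hf : Measurable f) :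
    ∫⁻ x, f (m + toEuclideanCLM (𝕜 := ℝ) K x) = ENNReal.ofReal |K.det⁻¹| * ∫⁻ y, f y := by
  have hmap := Measure.map_linearMap_addHaar_eq_smul_addHaar
    (volume : Measure (EuclideanSpace ℝ (Fin n))) (f := toLpLin 2 2 K)
    (by rwa [LinearMap.det_toLpLin])
  rw [LinearMap.det_toLpLin] at hmap
  have hcoe : ∀ x, toEuclideanCLM (𝕜 := ℝ) K x = toLpLin 2 2 K x := fun x => rfl
  have hmeas : Measurable (toLpLin 2 2 K : EuclideanSpace ℝ (Fin n) → EuclideanSpace ℝ (Fin n)) :=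
    (toEuclideanCLM (𝕜 := ℝ) K).continuous.measurable
  calc ∫⁻ x, f (m + toEuclideanCLM (𝕜 := ℝ) K x)
      = ∫⁻ y, f (m + y) ∂(Measure.map (toLpLin 2 2 K) volume) := by
        rw [lintegral_map (by fun_prop) hmeas]
        rfl
    _ = ENNReal.ofReal |K.det⁻¹| * ∫⁻ y, f y := by
        rw [hmap, lintegral_smul_measure, lintegral_add_left_eq_self, smul_eq_mul]

theorem norm_sq_toLp (v : Fin n → ℝ) :
    ‖(WithLp.toLp 2 v : EuclideanSpace ℝ (Fin n))‖ ^ 2 = v ⬝ᵥ v := by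
  rw [EuclideanSpace.real_norm_sq_eq]
  simp [dotProduct, sq]

/-- `N(μ, P)` has density `c det(P)^{-1/2} exp(-(y - μ)ᵀ P⁻¹ (y - μ) / 2)` where `c` depends on the
dimension only. -/
theorem exists_multivariateGaussian_eq_withDensity (n : ℕ) : ∃ c : ℝ, 0 < c ∧
    ∀ (μ : EuclideanSpace ℝ (Fin n)) (P : Matrix (Fin n) (Fin n) ℝ), P.PosDef →
    multivariateGaussian μ P = (volume : Measure (EuclideanSpace ℝ (Fin n))).withDensity
      (fun y => ENNReal.ofReal (c * (√P.det)⁻¹ *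
        Real.exp (-(1 / 2) * ((y.ofLp - μ.ofLp) ⬝ᵥ (P⁻¹ *ᵥ (y.ofLp - μ.ofLp)))))) := by
  obtain ⟨c, hc, hstd⟩ := exists_stdGaussian_eq_withDensity n
  refine ⟨c, hc, fun μ P hP => ?_⟩
  obtain ⟨hKpd, hKt, hKK⟩ := posDef_sqrt_and_mul_self hP
  have hdet : √P.det = (CFC.sqrt P).det := by
    rw [← hKK, det_mul, hKK, Real.sqrt_mul_self hKpd.det_pos.le]
  rw [multivariateGaussian, hstd]
  set K := CFC.sqrt P
  have hKu : IsUnit K.det := hKpd.det_pos.ne'.isUnit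
  have hquad (x : EuclideanSpace ℝ (Fin n)) :
      ((μ + toEuclideanCLM (𝕜 := ℝ) K x).ofLp - μ.ofLp) ⬝ᵥ
        (P⁻¹ *ᵥ ((μ + toEuclideanCLM (𝕜 := ℝ) K x).ofLp - μ.ofLp)) = ‖x‖ ^ 2 := by
    have h1 : (μ + toEuclideanCLM (𝕜 := ℝ) K x).ofLp - μ.ofLp = K *ᵥ x.ofLp := by
      simp [ofLp_toEuclideanCLM]
    rw [h1, ← hKK, Matrix.mul_inv_rev, mulVec_mulVec, Matrix.mul_assoc,
      Matrix.nonsing_inv_mul _ hKu, Matrix.mul_one, dotProduct_comm, dotProduct_mulVec,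
      ← mulVec_transpose, hKt, mulVec_mulVec, Matrix.mul_nonsing_inv _ hKu, one_mulVec,
      ← norm_sq_toLp]
  ext s hs
  have hF : Measurable fun y : EuclideanSpace ℝ (Fin n) => s.indicator
      (fun y => ENNReal.ofReal (c * Real.exp (-(1 / 2) * ((y.ofLp - μ.ofLp) ⬝ᵥ
        (P⁻¹ *ᵥ (y.ofLp - μ.ofLp)))))) y := by
    refine Measurable.indicator ?_ hs
    have : Continuous fun y : EuclideanSpace ℝ (Fin n) =>
        (y.ofLp - μ.ofLp) ⬝ᵥ (P⁻¹ *ᵥ (y.ofLp - μ.ofLp)) := by fun_prop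
    fun_prop
  have hmeas : Measurable fun x : EuclideanSpace ℝ (Fin n) => μ + toEuclideanCLM (𝕜 := ℝ) K x := by
    fun_prop
  rw [Measure.map_apply hmeas hs, withDensity_apply _ (hmeas hs), withDensity_apply _ hs,
    ← lintegral_indicator (hmeas hs)]
  have h2 := lintegral_comp_affine hKpd.det_pos.ne' μ hF
  have h3 : ∀ x, (((fun x => μ + toEuclideanCLM (𝕜 := ℝ) K x) ⁻¹' s).indicator
      (fun v => ENNReal.ofReal (c * Real.exp (-(1 / 2) * ‖v‖ ^ 2)))) x = s.indicator
      (fun y => ENNReal.ofReal (c * Real.exp (-(1 / 2) * ((y.ofLp - μ.ofLp) ⬝ᵥ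
        (P⁻¹ *ᵥ (y.ofLp - μ.ofLp)))))) (μ + toEuclideanCLM (𝕜 := ℝ) K x) := by
    intro x
    by_cases hx : μ + toEuclideanCLM (𝕜 := ℝ) K x ∈ s
    · have hx' : x ∈ (fun x => μ + toEuclideanCLM (𝕜 := ℝ) K x) ⁻¹' s := hx
      rw [Set.indicator_of_mem hx, Set.indicator_of_mem hx', hquad]
    · have hx' : x ∉ (fun x => μ + toEuclideanCLM (𝕜 := ℝ) K x) ⁻¹' s := hx
      rw [Set.indicator_of_notMem hx, Set.indicator_of_notMem hx']
  rw [lintegral_congr h3, h2, lintegral_indicator hs, ← lintegral_const_mul' _ _ (by simp)]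
  refine lintegral_congr fun y => ?_
  rw [← ENNReal.ofReal_mul (abs_nonneg _), hdet, abs_of_pos (inv_pos.2 hKpd.det_pos)]
  congr 1
  ring

theorem dotProduct_mulVec_comm_of_isSymm {M : Matrix (Fin n) (Fin n) ℝ} (hM : Mᵀ = M)
    (x y : Fin n → ℝ) : x ⬝ᵥ (M *ᵥ y) = y ⬝ᵥ (M *ᵥ x) := by
  rw [dotProduct_mulVec, ← mulVec_transpose, hM, dotProduct_comm]

theorem posDef_transpose_eq {M : Matrix (Fin n) (Fin n) ℝ} (hM : M.PosDef) : Mᵀ = M := by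
  simpa [IsHermitian, conjTranspose_eq_transpose_of_trivial] using hM.1

/-- Multiplying the law `N(μ, Q)` by the exponential of a quadratic function gives a multiple of
`N(P k, P)` where `k = Q⁻¹ μ + h`. -/
theorem withDensity_exp_quadratic_multivariateGaussian {Q P : Matrix (Fin n) (Fin n) ℝ}
    (hQ : Q.PosDef) (hP : P.PosDef) (μ : EuclideanSpace ℝ (Fin n)) (h k : Fin n → ℝ)
    (hk : k = Q⁻¹ *ᵥ μ.ofLp + h) :
    (multivariateGaussian μ Q).withDensity (fun y => ENNReal.ofReal (Real.exp
      ((1 / 2) * (y.ofLp ⬝ᵥ ((Q⁻¹ - P⁻¹) *ᵥ y.ofLp)) + h ⬝ᵥ y.ofLp))) =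
    ENNReal.ofReal (√P.det / √Q.det *
      Real.exp ((1 / 2) * (k ⬝ᵥ (P *ᵥ k)) - (1 / 2) * (μ.ofLp ⬝ᵥ (Q⁻¹ *ᵥ μ.ofLp)))) •
      multivariateGaussian (WithLp.toLp 2 (P *ᵥ k)) P := by
  obtain ⟨c, hc, hpdf⟩ := exists_multivariateGaussian_eq_withDensity n
  have hcont (M : Matrix (Fin n) (Fin n) ℝ) (m : Fin n → ℝ) :
      Continuous fun y : EuclideanSpace ℝ (Fin n) =>
        (y.ofLp - m) ⬝ᵥ (M *ᵥ (y.ofLp - m)) := by fun_prop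
  have hm1 (M : Matrix (Fin n) (Fin n) ℝ) (m : Fin n → ℝ) := (hcont M m).measurable
  have hcont2 : Continuous fun y : EuclideanSpace ℝ (Fin n) =>
      (1 / 2) * (y.ofLp ⬝ᵥ ((Q⁻¹ - P⁻¹) *ᵥ y.ofLp)) + h ⬝ᵥ y.ofLp := by fun_prop
  have hm2 := hcont2.measurable
  rw [hpdf μ Q hQ, hpdf _ P hP, ← withDensity_mul _ (by fun_prop) (by fun_prop),
    ← withDensity_smul' _ _ (by simp)]
  congr 1
  ext y
  simp only [Pi.mul_apply, Pi.smul_apply, smul_eq_mul]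
  have hPd := Real.sqrt_pos.2 hP.det_pos
  have hQd := Real.sqrt_pos.2 hQ.det_pos
  rw [← ENNReal.ofReal_mul (by positivity), ← ENNReal.ofReal_mul (by positivity)]
  congr 1
  have e1 : c * (√Q.det)⁻¹ *
        Real.exp (-(1 / 2) * ((y.ofLp - μ.ofLp) ⬝ᵥ (Q⁻¹ *ᵥ (y.ofLp - μ.ofLp)))) *
      Real.exp ((1 / 2) * (y.ofLp ⬝ᵥ ((Q⁻¹ - P⁻¹) *ᵥ y.ofLp)) + h ⬝ᵥ y.ofLp) =
      c * (√Q.det)⁻¹ * Real.exp (-(1 / 2) * ((y.ofLp - μ.ofLp) ⬝ᵥ (Q⁻¹ *ᵥ (y.ofLp - μ.ofLp))) +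
        ((1 / 2) * (y.ofLp ⬝ᵥ ((Q⁻¹ - P⁻¹) *ᵥ y.ofLp)) + h ⬝ᵥ y.ofLp)) := by
    rw [Real.exp_add (-(1 / 2) * _), mul_assoc]
  have e2 (a b : ℝ) : √P.det / √Q.det * Real.exp a * (c * (√P.det)⁻¹ * Real.exp b) =
      c * (√Q.det)⁻¹ * Real.exp (a + b) := by
    rw [Real.exp_add]
    field_simp
  rw [e1, e2]
  congr 2
  -- The remaining identity between exponents is completion of the square.
  have hQt := posDef_transpose_eq hQ.inv
  have hPt := posDef_transpose_eq hP.inv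
  have hPP : P⁻¹ *ᵥ (P *ᵥ k) = k := by
    rw [mulVec_mulVec, Matrix.nonsing_inv_mul _ hP.det_pos.ne'.isUnit, one_mulVec]
  simp only [sub_dotProduct, mulVec_sub, dotProduct_sub, sub_mulVec, hPP]
  rw [dotProduct_mulVec_comm_of_isSymm hQt μ.ofLp y.ofLp,
    dotProduct_mulVec_comm_of_isSymm hPt (P *ᵥ k) y.ofLp, hPP, dotProduct_comm (P *ᵥ k) k]
  have : y.ofLp ⬝ᵥ k = y.ofLp ⬝ᵥ (Q⁻¹ *ᵥ μ.ofLp) + h ⬝ᵥ y.ofLp := by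
    rw [hk, dotProduct_add, dotProduct_comm h]
  rw [this]
  ring

end Gaussian

/-! ### Duality for the conditional relative entropy supply -/

section Duality

/-- Gibbs variational inequality. -/
theorem ofReal_integral_sub_log_le_klDiv {Ω : Type*} [MeasurableSpace Ω] {μ ν : Measure Ω}
    [IsProbabilityMeasure μ] [IsProbabilityMeasure ν] (hμν : μ ≪ ν) {f : Ω → ℝ}
    (hfμ : Integrable f μ) (hfν : Integrable (fun w => Real.exp (f w)) ν) :
    ENNReal.ofReal (∫ w, f w ∂μ - Real.log (∫ w, Real.exp (f w) ∂ν)) ≤ klDiv μ ν := by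
  by_cases hint : Integrable (llr μ ν) μ
  · have := isProbabilityMeasure_tilted hfν
    -- Nonnegativity of the divergence of `μ` from the tilted `ν`, which equals `D(μ ‖ ν) - ∫ f dμ +
    -- ln ∫ exp f dν`.
    have h1 := integral_llr_add_sub_measure_univ_nonneg
      (hμν.trans (absolutelyContinuous_tilted hfν)) (integrable_llr_tilted_right hμν hfμ hint hfν)
    rw [integral_llr_tilted_right hμν hfμ hfν hint] at h1
    rw [klDiv_of_ac_of_integrable hμν hint]
    refine ENNReal.ofReal_le_ofReal ?_
    simp only [probReal_univ] at h1 ⊢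
    linarith
  · rw [klDiv_of_not_integrable hint]
    exact le_top

/-- Equality in the Gibbs variational inequality holds for the exponentially tilted measure. -/
theorem klDiv_tilted_eq {Ω : Type*} [MeasurableSpace Ω] {ν : Measure Ω}
    [IsProbabilityMeasure ν] {f : Ω → ℝ} (hfν : Integrable (fun w => Real.exp (f w)) ν)
    (hf : Integrable f (ν.tilted f)) :
    0 ≤ ∫ w, f w ∂(ν.tilted f) - Real.log (∫ w, Real.exp (f w) ∂ν) ∧
    klDiv (ν.tilted f) ν =
      ENNReal.ofReal (∫ w, f w ∂(ν.tilted f) - Real.log (∫ w, Real.exp (f w) ∂ν)) := by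
  have := isProbabilityMeasure_tilted hfν
  have hac : ν.tilted f ≪ ν := tilted_absolutelyContinuous ν f
  have hllr : llr (ν.tilted f) ν =ᵐ[ν.tilted f]
      fun w => f w - Real.log (∫ w, Real.exp (f w) ∂ν) :=
    hac.ae_le (log_rnDeriv_tilted_left_self hfν)
  have hint : Integrable (llr (ν.tilted f) ν) (ν.tilted f) :=
    (integrable_congr hllr).2 (hf.sub (integrable_const _))
  have hval : ∫ w, llr (ν.tilted f) ν w ∂(ν.tilted f) =
      ∫ w, f w ∂(ν.tilted f) - Real.log (∫ w, Real.exp (f w) ∂ν) := by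
    rw [integral_congr_ae hllr, integral_sub hf (integrable_const _)]
    simp
  have hnn := integral_llr_add_sub_measure_univ_nonneg hac hint
  rw [klDiv_of_ac_of_integrable hac hint]
  simp only [hval, probReal_univ, add_sub_cancel_right] at hnn ⊢
  exact ⟨hnn, trivial⟩

variable {X W : Type*} [MeasurableSpace X] [MeasurableSpace W]

/-- Fubini for `Φ ⊗ₘ κ`, whose image under the transition map is `Ψ`. This is how the terminal
constraint makes the mean of a potential the same for all driving strategies. -/
theorem integral_potential_eq {f : X → W → X} {R : Measure W} {t : ℕ}
    {Φ Ψ : Measure X} [IsProbabilityMeasure Φ] {κ : Kernel X (Fin t → W)}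
    (hκ : IsDrivingStrategy f R t Φ Ψ κ)
    (hF : Measurable fun y : X × (Fin t → W) => transitionMap f t y.1 y.2)
    {g : X → ℝ} (hg : Measurable g) (hgΨ : Integrable g Ψ) :
    (∀ᵐ x ∂Φ, Integrable (fun w => g (transitionMap f t x w)) (κ x)) ∧
    Integrable (fun x => ∫ w, g (transitionMap f t x w) ∂(κ x)) Φ ∧
    ∫ y, g y ∂Ψ = ∫ x, ∫ w, g (transitionMap f t x w) ∂(κ x) ∂Φ := by
  have := hκ.isMarkovKernel
  have hgF : Integrable (fun y : X × (Fin t → W) => g (transitionMap f t y.1 y.2)) (Φ ⊗ₘ κ) := by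
    rw [← hκ.terminalLaw_eq, terminalLaw] at hgΨ
    exact hgΨ.comp_measurable hF
  have hint : Integrable (fun x => ∫ w, g (transitionMap f t x w) ∂(κ x)) Φ := by
    have h := hgF
    rw [Measure.compProd] at h
    simpa using h.integral_compProd
  refine ⟨((Measure.integrable_compProd_iff hgF.1).1 hgF).1, hint, ?_⟩
  rw [← hκ.terminalLaw_eq, terminalLaw, integral_map hF.aemeasurable hg.aestronglyMeasurable,
    Measure.integral_compProd hgF]

/-- Weak duality: a potential `g` of the terminal state gives a lower bound on the supply. -/
theorem le_supply_of_potential {f : X → W → X} {R : Measure W} [IsProbabilityMeasure R] {t : ℕ}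
    {Φ Ψ : Measure X} [IsProbabilityMeasure Φ] {κ : Kernel X (Fin t → W)}
    (hκ : IsDrivingStrategy f R t Φ Ψ κ)
    (hF : Measurable fun y : X × (Fin t → W) => transitionMap f t y.1 y.2)
    {g : X → ℝ} (hg : Measurable g) (hgΨ : Integrable g Ψ) {ℓ : X → ℝ} (hℓ : Integrable ℓ Φ)
    (hexp : ∀ x, Integrable (fun w => Real.exp (g (transitionMap f t x w))) (nominalNoise R t))
    (hℓe : ∀ x, ℓ x = Real.log (∫ w, Real.exp (g (transitionMap f t x w)) ∂(nominalNoise R t))) :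
    ENNReal.ofReal (∫ y, g y ∂Ψ - ∫ x, ℓ x ∂Φ) ≤ supply R t Φ κ := by
  have := hκ.isMarkovKernel
  have : IsProbabilityMeasure (nominalNoise R t) := by unfold nominalNoise; infer_instance
  obtain ⟨hae, hint1, hgi⟩ := integral_potential_eq hκ hF hg hgΨ
  rw [hgi, ← integral_sub hint1 hℓ, supply]
  -- The pointwise Gibbs bound may be negative, while the divergence lies in `[0, ∞]`; passing to
  -- the positive part lets the two be compared as `lintegral`s.
  calc ENNReal.ofReal (∫ x, ((∫ w, g (transitionMap f t x w) ∂(κ x)) - ℓ x) ∂Φ)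
      ≤ ENNReal.ofReal (∫ x, max ((∫ w, g (transitionMap f t x w) ∂(κ x)) - ℓ x) 0 ∂Φ) := by
        refine ENNReal.ofReal_le_ofReal (integral_mono (hint1.sub hℓ) (hint1.sub hℓ).pos_part ?_)
        exact fun x => le_max_left _ _
    _ = ∫⁻ x, ENNReal.ofReal (max ((∫ w, g (transitionMap f t x w) ∂(κ x)) - ℓ x) 0) ∂Φ :=
        ofReal_integral_eq_lintegral_ofReal (hint1.sub hℓ).pos_part
          (Filter.Eventually.of_forall fun x => le_max_right _ _)
    _ ≤ ∫⁻ x, klDiv (κ x) (nominalNoise R t) ∂Φ := by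
        refine lintegral_mono_ae ?_
        filter_upwards [hae, hκ.absolutelyContinuous] with x hx hac
        rw [ENNReal.ofReal_max, ENNReal.ofReal_zero, max_eq_left zero_le, hℓe x]
        exact ofReal_integral_sub_log_le_klDiv hac hx (hexp x)

/-- A strategy that tilts the nominal noise by a potential `g` of the terminal state attains the
dual bound. -/
theorem supply_eq_of_tilted {f : X → W → X} {R : Measure W} [IsProbabilityMeasure R] {t : ℕ}
    {Φ Ψ : Measure X} [IsProbabilityMeasure Φ] {κ : Kernel X (Fin t → W)}
    (hκ : IsDrivingStrategy f R t Φ Ψ κ)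
    (hF : Measurable fun y : X × (Fin t → W) => transitionMap f t y.1 y.2)
    {g : X → ℝ} (hg : Measurable g) (hgΨ : Integrable g Ψ) {ℓ : X → ℝ} (hℓ : Integrable ℓ Φ)
    (hexp : ∀ x, Integrable (fun w => Real.exp (g (transitionMap f t x w))) (nominalNoise R t))
    (hℓe : ∀ x, ℓ x = Real.log (∫ w, Real.exp (g (transitionMap f t x w)) ∂(nominalNoise R t)))
    (htilt : ∀ x, κ x = (nominalNoise R t).tilted fun w => g (transitionMap f t x w)) :
    0 ≤ ∫ y, g y ∂Ψ - ∫ x, ℓ x ∂Φ ∧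
      supply R t Φ κ = ENNReal.ofReal (∫ y, g y ∂Ψ - ∫ x, ℓ x ∂Φ) := by
  have := hκ.isMarkovKernel
  have : IsProbabilityMeasure (nominalNoise R t) := by unfold nominalNoise; infer_instance
  obtain ⟨hae, hint1, hgi⟩ := integral_potential_eq hκ hF hg hgΨ
  have hkl : ∀ᵐ x ∂Φ, 0 ≤ (∫ w, g (transitionMap f t x w) ∂(κ x)) - ℓ x ∧
      klDiv (κ x) (nominalNoise R t) =
        ENNReal.ofReal ((∫ w, g (transitionMap f t x w) ∂(κ x)) - ℓ x) := by
    filter_upwards [hae] with x hx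
    rw [hℓe x]
    rw [htilt x] at hx ⊢
    exact klDiv_tilted_eq (hexp x) hx
  rw [hgi, ← integral_sub hint1 hℓ, supply, lintegral_congr_ae (hkl.mono fun x hx => hx.2)]
  exact ⟨integral_nonneg_of_ae (hkl.mono fun x hx => hx.1),
    (ofReal_integral_eq_lintegral_ofReal (hint1.sub hℓ) (hkl.mono fun x hx => hx.1)).symm⟩

/-- The Markov kernel that tilts a fixed probability measure by a measurable family of potentials. -/
theorem exists_kernel_eq_tilted {Ω : Type*} [MeasurableSpace Ω] (ν : Measure Ω)
    [IsProbabilityMeasure ν] {φ : X → Ω → ℝ} (hφ : Measurable (Function.uncurry φ))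
    (hexp : ∀ x, Integrable (fun w => Real.exp (φ x w)) ν) :
    ∃ κ : Kernel X Ω, IsMarkovKernel κ ∧ ∀ x, κ x = ν.tilted (φ x) := by
  have hZ : Measurable fun x => ∫ w, Real.exp (φ x w) ∂ν :=
    (StronglyMeasurable.integral_prod_right (f := fun x w => Real.exp (φ x w))
      (hφ.exp.stronglyMeasurable)).measurable
  have hmeas : Measurable (Function.uncurry fun x w =>
      ENNReal.ofReal (Real.exp (φ x w) / ∫ w, Real.exp (φ x w) ∂ν)) :=
    (hφ.exp.div (hZ.comp measurable_fst)).ennreal_ofReal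
  have hκ : ∀ x, ((Kernel.const X ν).withDensity fun x w =>
      ENNReal.ofReal (Real.exp (φ x w) / ∫ w, Real.exp (φ x w) ∂ν)) x = ν.tilted (φ x) := by
    intro x
    rw [Kernel.withDensity_apply _ hmeas, Kernel.const_apply, Measure.tilted]
  exact ⟨_, ⟨fun x => by rw [hκ x]; exact isProbabilityMeasure_tilted (hexp x)⟩, hκ⟩

end Duality

/-! ### Moments of Gaussian laws and laws of the terminal state -/

section Moments

variable {n : ℕ}

theorem memLp_coord (α : EuclideanSpace ℝ (Fin n)) (S : Matrix (Fin n) (Fin n) ℝ)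
    (i : Fin n) : MemLp (fun x : EuclideanSpace ℝ (Fin n) => x.ofLp i) 2
      (multivariateGaussian α S) :=
  IsGaussian.memLp_dual _ (EuclideanSpace.proj i) 2 (by simp)

theorem integrable_coord (α : EuclideanSpace ℝ (Fin n)) (S : Matrix (Fin n) (Fin n) ℝ)
    (i : Fin n) : Integrable (fun x : EuclideanSpace ℝ (Fin n) => x.ofLp i)
      (multivariateGaussian α S) :=
  (memLp_coord α S i).integrable (by norm_num)

theorem integral_coord (α : EuclideanSpace ℝ (Fin n)) (S : Matrix (Fin n) (Fin n) ℝ)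
    (i : Fin n) : ∫ x, x.ofLp i ∂(multivariateGaussian α S) = α.ofLp i := by
  have h := (EuclideanSpace.proj (𝕜 := ℝ) i).integral_comp_comm
    (IsGaussian.integrable_id (μ := multivariateGaussian α S))
  simpa using h

theorem integral_coord_mul_coord (α : EuclideanSpace ℝ (Fin n)) {S : Matrix (Fin n) (Fin n) ℝ}
    (hS : S.PosSemidef) (i j : Fin n) :
    ∫ x, x.ofLp i * x.ofLp j ∂(multivariateGaussian α S) = S i j + α.ofLp i * α.ofLp j := by
  have h := covariance_eq_sub (memLp_coord α S i) (memLp_coord α S j)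
  rw [covariance_eval_multivariateGaussian hS, integral_coord, integral_coord] at h
  simp only [Pi.mul_apply] at h
  linarith

theorem integrable_quadratic (α : EuclideanSpace ℝ (Fin n)) (S M : Matrix (Fin n) (Fin n) ℝ)
    (c : Fin n → ℝ) (d : ℝ) :
    Integrable (fun x : EuclideanSpace ℝ (Fin n) => x.ofLp ⬝ᵥ (M *ᵥ x.ofLp) + c ⬝ᵥ x.ofLp + d)
      (multivariateGaussian α S) := by
  refine ((integrable_finsetSum _ fun i _ => ?_).add
    (integrable_finsetSum _ fun i _ => (integrable_coord α S i).const_mul _)).add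
    (integrable_const _)
  simp only [mulVec, dotProduct, Finset.mul_sum]
  refine integrable_finsetSum _ fun j _ => ?_
  have := ((memLp_coord α S i).integrable_mul (memLp_coord α S j)).const_mul (M i j)
  refine this.congr (Filter.Eventually.of_forall fun x => ?_)
  simp only [Pi.mul_apply]
  ring

theorem integral_quadratic (α : EuclideanSpace ℝ (Fin n)) {S : Matrix (Fin n) (Fin n) ℝ}
    (hS : S.PosSemidef) (M : Matrix (Fin n) (Fin n) ℝ) (c : Fin n → ℝ) (d : ℝ) :
    ∫ x, (x.ofLp ⬝ᵥ (M *ᵥ x.ofLp) + c ⬝ᵥ x.ofLp + d) ∂(multivariateGaussian α S) =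
      trace (M * S) + α.ofLp ⬝ᵥ (M *ᵥ α.ofLp) + c ⬝ᵥ α.ofLp + d := by
  have hq (i j : Fin n) : Integrable (fun x : EuclideanSpace ℝ (Fin n) =>
      M i j * (x.ofLp i * x.ofLp j)) (multivariateGaussian α S) :=
    ((memLp_coord α S i).integrable_mul (memLp_coord α S j)).const_mul (M i j)
  have hl (i : Fin n) := (integrable_coord α S i).const_mul (c i)
  have hsq (v : Fin n → ℝ) : v ⬝ᵥ (M *ᵥ v) = ∑ i, ∑ j, M i j * (v i * v j) := by
    simp only [mulVec, dotProduct, Finset.mul_sum]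
    exact Finset.sum_congr rfl fun i _ => Finset.sum_congr rfl fun j _ => by ring
  simp only [hsq]
  simp only [dotProduct]
  rw [integral_add (by fun_prop) (integrable_const _), integral_add (by fun_prop) (by fun_prop),
    integral_finsetSum _ (fun i _ => by fun_prop), integral_finsetSum _ (fun i _ => hl i)]
  simp only [integral_const_mul, integral_coord, integral_finsetSum _ (fun j _ => hq _ j),
    integral_coord_mul_coord α hS, integral_const, probReal_univ, one_smul]
  congr 2
  simp only [trace, diag, Matrix.mul_apply, mul_add, Finset.sum_add_distrib]
  congr 1
  refine Finset.sum_congr rfl fun i _ => Finset.sum_congr rfl fun j _ => ?_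
  rw [← hS.1.apply i j]
  simp

end Moments

/-! ### Terminal laws by characteristic functions -/

section TerminalLaw

variable {n m : ℕ}

theorem measurable_transitionMap_linearStep (A : Matrix (Fin n) (Fin n) ℝ)
    (B : Matrix (Fin n) (Fin m) ℝ) (t : ℕ) :
    Measurable fun y : EuclideanSpace ℝ (Fin n) × (Fin t → EuclideanSpace ℝ (Fin m)) =>
      transitionMap (linearStep A B) t y.1 y.2 := by
  simp only [transitionMap_linearStep]
  have : Continuous fun y : EuclideanSpace ℝ (Fin n) × (Fin t → EuclideanSpace ℝ (Fin m)) =>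
      (WithLp.toLp 2 (A ^ t *ᵥ y.1.ofLp + ∑ k : Fin t, (A ^ (t - 1 - k) * B) *ᵥ (y.2 k).ofLp) :
        EuclideanSpace ℝ (Fin n)) := by fun_prop
  exact this.measurable

open scoped RealInnerProductSpace in
theorem inner_eq_dotProduct (x y : EuclideanSpace ℝ (Fin n)) : ⟪x, y⟫ = x.ofLp ⬝ᵥ y.ofLp := by
  rw [EuclideanSpace.inner_eq_star_dotProduct, star_trivial, dotProduct_comm]

/-- Under the nominal noise the state at time `t` started at `x` has law `N(A^t x, Γ_t)`. -/
theorem map_transitionMap_nominalNoise (A : Matrix (Fin n) (Fin n) ℝ)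
    (B : Matrix (Fin n) (Fin m) ℝ) (t : ℕ) (hΓ : (gramian A B t).PosSemidef)
    (x : EuclideanSpace ℝ (Fin n)) :
    (nominalNoise (multivariateGaussian 0 (1 : Matrix (Fin m) (Fin m) ℝ)) t).map
      (transitionMap (linearStep A B) t x) =
    multivariateGaussian (WithLp.toLp 2 (A ^ t *ᵥ x.ofLp)) (gramian A B t) := by
  have hmeas : Measurable (transitionMap (linearStep A B) t x) :=
    (measurable_transitionMap_linearStep A B t).comp measurable_prodMk_left
  have : IsProbabilityMeasure
      (nominalNoise (multivariateGaussian 0 (1 : Matrix (Fin m) (Fin m) ℝ)) t) := by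
    unfold nominalNoise; infer_instance
  have := Measure.isProbabilityMeasure_map
    (μ := nominalNoise (multivariateGaussian 0 (1 : Matrix (Fin m) (Fin m) ℝ)) t) hmeas.aemeasurable
  refine Measure.ext_of_charFun (funext fun ξ => ?_)
  rw [charFun_multivariateGaussian hΓ, charFun_apply, integral_map hmeas.aemeasurable (by fun_prop)]
  -- The state is affine in independent noises, so the exponential splits into one factor per time
  -- step and the integral becomes a product of characteristic functions.
  have hin (w : Fin t → EuclideanSpace ℝ (Fin m)) :
      Complex.exp (((inner ℝ (transitionMap (linearStep A B) t x w) ξ : ℝ) : ℂ) * Complex.I) =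
      Complex.exp (((inner ℝ ξ (WithLp.toLp 2 (A ^ t *ᵥ x.ofLp)) : ℝ) : ℂ) * Complex.I) *
        ∏ k : Fin t, Complex.exp (((inner ℝ (w k)
          (WithLp.toLp 2 (ξ.ofLp ᵥ* (A ^ (t - 1 - k) * B)) : EuclideanSpace ℝ (Fin m)) : ℝ) : ℂ) *
            Complex.I) := by
    rw [← Complex.exp_sum, ← Complex.exp_add, ← Finset.sum_mul, ← add_mul, ← Complex.ofReal_sum,
      ← Complex.ofReal_add, transitionMap_linearStep]
    simp only [inner_eq_dotProduct, add_dotProduct, sum_dotProduct]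
    congr 4
    · rw [dotProduct_comm]
    · refine Finset.sum_congr rfl fun k _ => ?_
      rw [dotProduct_comm, dotProduct_mulVec, dotProduct_comm]
  simp only [hin]
  rw [integral_const_mul, nominalNoise, integral_fintype_prod_eq_prod (𝕜 := ℂ)
    (f := fun (k : Fin t) (v : EuclideanSpace ℝ (Fin m)) => Complex.exp (((inner ℝ v
      (WithLp.toLp 2 (ξ.ofLp ᵥ* (A ^ (t - 1 - k) * B)) : EuclideanSpace ℝ (Fin m)) : ℝ) : ℂ) *
        Complex.I))]
  simp only [← charFun_apply, multivariateGaussian_zero_one, charFun_stdGaussian]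
  rw [← Complex.exp_sum, ← Complex.exp_add, sub_eq_add_neg]
  congr 2
  -- The noise at time `k` is propagated by `A ^ (t - 1 - k)`, so the Gramian sum is read in reverse
  -- order.
  rw [dotProduct_gramian_mulVec, ← Finset.sum_range_reflect, ← Fin.sum_univ_eq_sum_range
    (fun k => (ξ.ofLp ᵥ* (A ^ (t - 1 - k) * B)) ⬝ᵥ (ξ.ofLp ᵥ* (A ^ (t - 1 - k) * B))),
    Complex.ofReal_sum, Finset.sum_div, ← Finset.sum_neg_distrib]
  refine Finset.sum_congr rfl fun k _ => ?_
  rw [← Complex.ofReal_pow, norm_sq_toLp, neg_div]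

/-- A Gaussian mixture of Gaussian laws whose mean is an affine function of the mixing variable. -/
theorem terminalLaw_eq_multivariateGaussian {W : Type*} [MeasurableSpace W]
    {f : EuclideanSpace ℝ (Fin n) → W → EuclideanSpace ℝ (Fin n)} {t : ℕ}
    (hF : Measurable fun y : EuclideanSpace ℝ (Fin n) × (Fin t → W) => transitionMap f t y.1 y.2)
    {α β : EuclideanSpace ℝ (Fin n)} {S P Θ C : Matrix (Fin n) (Fin n) ℝ} {c : Fin n → ℝ}
    (hS : S.PosSemidef) (hP : P.PosSemidef) (hΘ : Θ.PosSemidef)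
    {κ : Kernel (EuclideanSpace ℝ (Fin n)) (Fin t → W)} [IsMarkovKernel κ]
    (hκ : ∀ x, (κ x).map (transitionMap f t x) =
      multivariateGaussian (WithLp.toLp 2 (C *ᵥ x.ofLp + c)) P)
    (hβ : β.ofLp = C *ᵥ α.ofLp + c) (hΘeq : Θ = P + C * S * Cᵀ) :
    terminalLaw f t (multivariateGaussian α S) κ = multivariateGaussian β Θ := by
  have := Measure.isProbabilityMeasure_map (μ := multivariateGaussian α S ⊗ₘ κ) hF.aemeasurable
  unfold terminalLaw
  refine Measure.ext_of_charFun (funext fun ξ => ?_)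
  have hmx (x : EuclideanSpace ℝ (Fin n)) : Measurable (transitionMap f t x) :=
    hF.comp measurable_prodMk_left
  have hcm : Measurable fun y : EuclideanSpace ℝ (Fin n) × (Fin t → W) =>
      Complex.exp (((inner ℝ (transitionMap f t y.1 y.2) ξ : ℝ) : ℂ) * Complex.I) := by fun_prop
  rw [charFun_apply, integral_map hF.aemeasurable (by fun_prop), Measure.integral_compProd
    (Integrable.of_bound hcm.aestronglyMeasurable 1 (Filter.Eventually.of_forall fun y => by
      rw [Complex.norm_exp_ofReal_mul_I]))]
  -- Conditionally on `x`, the characteristic function is a constant times a character of `x` at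
  -- frequency `Cᵀ ξ`; the outer integral is then the characteristic function of `N(α, S)` at `Cᵀ
  -- ξ`.
  have hinner (x : EuclideanSpace ℝ (Fin n)) :
      ∫ w, Complex.exp (((inner ℝ (transitionMap f t x w) ξ : ℝ) : ℂ) * Complex.I) ∂(κ x) =
      Complex.exp (((inner ℝ x (WithLp.toLp 2 (Cᵀ *ᵥ ξ.ofLp) : EuclideanSpace ℝ (Fin n)) : ℝ) : ℂ) *
        Complex.I) * Complex.exp (((ξ.ofLp ⬝ᵥ c : ℝ) : ℂ) * Complex.I -
          ((ξ.ofLp ⬝ᵥ (P *ᵥ ξ.ofLp) : ℝ) : ℂ) / 2) := by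
    have h := charFun_multivariateGaussian (μ := WithLp.toLp 2 (C *ᵥ x.ofLp + c)) hP ξ
    rw [← hκ x, charFun_apply, integral_map (hmx x).aemeasurable (by fun_prop)] at h
    rw [h, ← Complex.exp_add]
    congr 1
    rw [inner_eq_dotProduct, inner_eq_dotProduct, dotProduct_add, dotProduct_mulVec,
      ← mulVec_transpose, dotProduct_comm x.ofLp]
    push_cast
    ring
  simp only [hinner]
  rw [integral_mul_const, ← charFun_apply, charFun_multivariateGaussian hS,
    charFun_multivariateGaussian hΘ, ← Complex.exp_add]
  congr 1
  rw [inner_eq_dotProduct, inner_eq_dotProduct, hβ, hΘeq]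
  have e1 : ξ.ofLp ⬝ᵥ ((P + C * S * Cᵀ) *ᵥ ξ.ofLp) =
      ξ.ofLp ⬝ᵥ (P *ᵥ ξ.ofLp) + (Cᵀ *ᵥ ξ.ofLp) ⬝ᵥ (S *ᵥ (Cᵀ *ᵥ ξ.ofLp)) := by
    rw [add_mulVec, dotProduct_add, ← mulVec_mulVec, ← mulVec_mulVec,
      dotProduct_mulVec ξ.ofLp C, ← mulVec_transpose]
  have e2 : ξ.ofLp ⬝ᵥ (C *ᵥ α.ofLp + c) = (Cᵀ *ᵥ ξ.ofLp) ⬝ᵥ α.ofLp + ξ.ofLp ⬝ᵥ c := by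
    rw [dotProduct_add, dotProduct_mulVec, ← mulVec_transpose]
  rw [e1, e2]
  push_cast
  ring

end TerminalLaw

/-! ### The minimum supply between Gaussian laws -/

section Tilting

variable {Ω Y : Type*} [MeasurableSpace Ω] [MeasurableSpace Y]

theorem map_tilted_comp (μ : Measure Ω) {F : Ω → Y} (hF : Measurable F) {g : Y → ℝ}
    (hg : Measurable g) : (μ.tilted (g ∘ F)).map F = (μ.map F).tilted g := by
  ext s hs
  rw [Measure.map_apply hF hs, tilted_apply' _ _ (hF hs), tilted_apply' _ _ hs,
    integral_map hF.aemeasurable hg.exp.aestronglyMeasurable, setLIntegral_map hs (by fun_prop) hF]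
  rfl

/-- Total mass identifies `Z` as the normalizing constant, so a single density identity yields
integrability, the exponential moment and the tilted law. -/
theorem tilted_eq_of_withDensity_eq {μ η : Measure Y} [IsProbabilityMeasure η] {g : Y → ℝ}
    (hg : Measurable g) {Z : ℝ} (hZ : 0 < Z)
    (h : μ.withDensity (fun y => ENNReal.ofReal (Real.exp (g y))) = ENNReal.ofReal Z • η) :
    Integrable (fun y => Real.exp (g y)) μ ∧ ∫ y, Real.exp (g y) ∂μ = Z ∧ μ.tilted g = η := by
  have h1 : ∫⁻ y, ENNReal.ofReal (Real.exp (g y)) ∂μ = ENNReal.ofReal Z := by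
    have := congrArg (fun m => m Set.univ) h
    simpa using this
  have hnn : 0 ≤ᵐ[μ] fun y => Real.exp (g y) := Filter.Eventually.of_forall fun y => by positivity
  have hint : Integrable (fun y => Real.exp (g y)) μ :=
    (lintegral_ofReal_ne_top_iff_integrable hg.exp.aestronglyMeasurable hnn).1 (by simp [h1])
  have hval : ∫ y, Real.exp (g y) ∂μ = Z := by
    rw [integral_eq_lintegral_of_nonneg_ae hnn hg.exp.aestronglyMeasurable, h1,
      ENNReal.toReal_ofReal hZ.le]
  refine ⟨hint, hval, ?_⟩
  have h2 : (fun y => ENNReal.ofReal (Real.exp (g y) / Z)) =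
      (ENNReal.ofReal Z)⁻¹ • fun y => ENNReal.ofReal (Real.exp (g y)) := by
    ext y
    rw [ENNReal.ofReal_div_of_pos hZ, Pi.smul_apply, smul_eq_mul, div_eq_mul_inv, mul_comm]
  rw [Measure.tilted, hval, h2, withDensity_smul _ (by fun_prop), h, smul_smul,
    ENNReal.inv_mul_cancel (by simpa using hZ) (by simp), one_smul]

end Tilting

section Gaussian

variable {n m : ℕ}

theorem dotProduct_mulVec_affine {P N : Matrix (Fin n) (Fin n) ℝ} (hP : Pᵀ = P) (x h : Fin n → ℝ) :
    (N *ᵥ x + h) ⬝ᵥ (P *ᵥ (N *ᵥ x + h)) =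
      x ⬝ᵥ ((Nᵀ * P * N) *ᵥ x) + 2 * ((Nᵀ * P) *ᵥ h) ⬝ᵥ x + h ⬝ᵥ (P *ᵥ h) := by
  have e1 : (N *ᵥ x) ⬝ᵥ (P *ᵥ (N *ᵥ x)) = x ⬝ᵥ ((Nᵀ * P * N) *ᵥ x) := by
    rw [← mulVec_mulVec, ← mulVec_mulVec, dotProduct_mulVec x, ← mulVec_transpose,
      transpose_transpose]
  have e2 : (N *ᵥ x) ⬝ᵥ (P *ᵥ h) = ((Nᵀ * P) *ᵥ h) ⬝ᵥ x := by
    rw [← mulVec_mulVec, dotProduct_comm _ x, dotProduct_mulVec x, ← mulVec_transpose,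
      transpose_transpose]
  simp only [mulVec_add, dotProduct_add, add_dotProduct]
  rw [e1, e2, dotProduct_mulVec_comm_of_isSymm hP h (N *ᵥ x), e2]
  ring

/-- The optimal supply in terms of the terminal covariance `P` of the state conditioned on `X_0`. -/
theorem minSupply_multivariateGaussian {A : Matrix (Fin n) (Fin n) ℝ}
    {B : Matrix (Fin n) (Fin m) ℝ} {t : ℕ} (hΓ : (gramian A B t).PosDef)
    (α β : EuclideanSpace ℝ (Fin n)) {S Θ P : Matrix (Fin n) (Fin n) ℝ}
    (hS : S.PosSemidef) (hΘ : Θ.PosSemidef) (hP : P.PosDef)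
    (hPΘ : Θ = P + P * ((gramian A B t)⁻¹ * (A ^ t * S * (A ^ t)ᵀ) * (gramian A B t)⁻¹) * P) :
    ∃ r : ℝ, 0 ≤ r ∧
      minSupply (linearStep A B) (multivariateGaussian 0 1) t (multivariateGaussian α S)
        (multivariateGaussian β Θ) = ENNReal.ofReal r ∧
      r = (weightedNormSq (gramian A B t)⁻¹ (β.ofLp - A ^ t *ᵥ α.ofLp) +
        (trace ((gramian A B t)⁻¹ * Θ) + trace ((gramian A B t)⁻¹ * (A ^ t * S * (A ^ t)ᵀ)) -
          trace (1 + (2 : ℝ) • ((gramian A B t)⁻¹ * (A ^ t * S * (A ^ t)ᵀ) *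
            (gramian A B t)⁻¹ * P))) - (Real.log P.det - Real.log (gramian A B t).det)) / 2 := by
  have hmap := map_transitionMap_nominalNoise A B t hΓ.posSemidef
  have hFm := measurable_transitionMap_linearStep A B t
  have hΓt := posDef_transpose_eq hΓ.inv
  have hPt := posDef_transpose_eq hP
  have hPit := posDef_transpose_eq hP.inv
  have hPu := hP.det_pos.ne'.isUnit
  have hdP := hP.det_pos
  have hdΓ := hΓ.det_pos
  set Γ := gramian A B t
  set D := A ^ t
  set R : Measure (EuclideanSpace ℝ (Fin m)) := multivariateGaussian 0 1
  set F := transitionMap (linearStep A B) t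
  set N := Γ⁻¹ * D with hN
  -- Chosen so that the mean `P (N α + h)` of the terminal law is `β`.
  set h : Fin n → ℝ := P⁻¹ *ᵥ β.ofLp - N *ᵥ α.ofLp with hh
  have hNα : N *ᵥ α.ofLp + h = P⁻¹ *ᵥ β.ofLp := by rw [hh]; abel
  set g : EuclideanSpace ℝ (Fin n) → ℝ := fun y =>
    (1 / 2) * (y.ofLp ⬝ᵥ ((Γ⁻¹ - P⁻¹) *ᵥ y.ofLp)) + h ⬝ᵥ y.ofLp with hg
  have hgm : Measurable g := by
    have : Continuous g := by fun_prop
    exact this.measurable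
  set Z : EuclideanSpace ℝ (Fin n) → ℝ := fun x => √P.det / √Γ.det *
    Real.exp ((1 / 2) * ((N *ᵥ x.ofLp + h) ⬝ᵥ (P *ᵥ (N *ᵥ x.ofLp + h))) -
      (1 / 2) * ((D *ᵥ x.ofLp) ⬝ᵥ (Γ⁻¹ *ᵥ (D *ᵥ x.ofLp)))) with hZ
  have hZpos (x) : 0 < Z x := by
    have := Real.sqrt_pos.2 hdP
    have := Real.sqrt_pos.2 hdΓ
    positivity
  have htilt (x : EuclideanSpace ℝ (Fin n)) := tilted_eq_of_withDensity_eq hgm (hZpos x)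
    (withDensity_exp_quadratic_multivariateGaussian hΓ hP (WithLp.toLp 2 (D *ᵥ x.ofLp)) h
      (N *ᵥ x.ofLp + h) (by rw [hN, mulVec_mulVec]))
  have hFx (x) : Measurable (F x) := hFm.comp measurable_prodMk_left
  have hexp (x) : Integrable (fun w => Real.exp (g (F x w))) (nominalNoise R t) := by
    have h1 := (htilt x).1
    rw [← hmap x] at h1
    exact h1.comp_measurable (hFx x)
  have hval (x) : ∫ w, Real.exp (g (F x w)) ∂(nominalNoise R t) = Z x := by
    rw [← (htilt x).2.1, ← hmap x, integral_map (hFx x).aemeasurable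
      hgm.exp.aestronglyMeasurable]
  have : IsProbabilityMeasure (nominalNoise R t) := by unfold nominalNoise; infer_instance
  obtain ⟨κ, hκM, hκ⟩ := exists_kernel_eq_tilted (X := EuclideanSpace ℝ (Fin n))
    (nominalNoise R t) (φ := fun x w => g (F x w)) (hgm.comp hFm) hexp
  have hκF (x) : (κ x).map (F x) =
      multivariateGaussian (WithLp.toLp 2 ((P * N) *ᵥ x.ofLp + P *ᵥ h)) P := by
    have h1 := map_tilted_comp (nominalNoise R t) (hFx x) hgm
    rw [hmap x, (htilt x).2.2] at h1
    rw [hκ x, ← mulVec_mulVec, ← mulVec_add, ← h1]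
    rfl
  have hstrat : IsDrivingStrategy (linearStep A B) R t (multivariateGaussian α S)
      (multivariateGaussian β Θ) κ := by
    refine ⟨hκM, Filter.Eventually.of_forall fun x => ?_, ?_⟩
    · rw [hκ x]
      exact tilted_absolutelyContinuous _ _
    · refine terminalLaw_eq_multivariateGaussian hFm hS hP.posSemidef hΘ hκF ?_ ?_
      · rw [← mulVec_mulVec, ← mulVec_add, hNα, mulVec_mulVec, Matrix.mul_nonsing_inv _ hPu,
          one_mulVec]
      · rw [hPΘ, hN]
        simp only [transpose_mul, hPt, hΓt, Matrix.mul_assoc]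
  set ℓ : EuclideanSpace ℝ (Fin n) → ℝ := fun x => Real.log (Z x) with hℓ
  have hℓe (x) : ℓ x = Real.log (∫ w, Real.exp (g (F x w)) ∂(nominalNoise R t)) := by
    rw [hval x]
  have hlogZ (x) : ℓ x = (1 / 2) * (Real.log P.det - Real.log Γ.det) +
      ((1 / 2) * ((N *ᵥ x.ofLp + h) ⬝ᵥ (P *ᵥ (N *ᵥ x.ofLp + h))) -
      (1 / 2) * ((D *ᵥ x.ofLp) ⬝ᵥ (Γ⁻¹ *ᵥ (D *ᵥ x.ofLp)))) := by
    have h1 := (Real.sqrt_pos.2 hdP).ne'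
    have h2 := (Real.sqrt_pos.2 hdΓ).ne'
    simp only [hℓ, hZ]
    rw [Real.log_mul (div_ne_zero h1 h2) (Real.exp_ne_zero _), Real.log_exp,
      Real.log_div h1 h2, Real.log_sqrt hdP.le, Real.log_sqrt hdΓ.le]
    ring
  -- The log-partition function `ℓ` is again quadratic, with matrix `M`, so its `Φ`-mean is `trace
  -- (M * S) + ℓ α`.
  set M : Matrix (Fin n) (Fin n) ℝ := (1 / 2 : ℝ) • (Nᵀ * P * N - Dᵀ * Γ⁻¹ * D) with hM
  have hquad (x) : ℓ x = x.ofLp ⬝ᵥ (M *ᵥ x.ofLp) + ((Nᵀ * P) *ᵥ h) ⬝ᵥ x.ofLp +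
      ((1 / 2) * (Real.log P.det - Real.log Γ.det) + (1 / 2) * (h ⬝ᵥ (P *ᵥ h))) := by
    have h3 := dotProduct_mulVec_affine (N := D) hΓt x.ofLp 0
    simp only [add_zero, mulVec_zero, zero_dotProduct, dotProduct_zero, mul_zero] at h3
    rw [hlogZ, dotProduct_mulVec_affine hPt, h3, hM, smul_mulVec, sub_mulVec, dotProduct_smul,
      dotProduct_sub, smul_eq_mul]
    ring
  have hℓint : Integrable ℓ (multivariateGaussian α S) := by
    simp only [funext hquad]
    exact integrable_quadratic α S M _ _
  have hℓval : ∫ x, ℓ x ∂(multivariateGaussian α S) = trace (M * S) + ℓ α := by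
    simp only [hquad]
    rw [integral_quadratic α hS M]
    ring
  have hgq (y : EuclideanSpace ℝ (Fin n)) : g y =
      y.ofLp ⬝ᵥ (((1 / 2 : ℝ) • (Γ⁻¹ - P⁻¹)) *ᵥ y.ofLp) + h ⬝ᵥ y.ofLp + 0 := by
    simp only [hg, smul_mulVec, dotProduct_smul, smul_eq_mul, add_zero]
  have hgint : Integrable g (multivariateGaussian β Θ) := by
    simp only [funext hgq]
    exact integrable_quadratic β Θ _ _ _
  have hgval : ∫ y, g y ∂(multivariateGaussian β Θ) =
      trace (((1 / 2 : ℝ) • (Γ⁻¹ - P⁻¹)) * Θ) + g β := by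
    simp only [hgq]
    rw [integral_quadratic β hΘ]
    ring
  obtain ⟨hr, hsup⟩ := supply_eq_of_tilted hstrat hFm hgm hgint hℓint hexp hℓe hκ
  refine ⟨_, hr, le_antisymm ?_ ?_, ?_⟩
  · rw [← hsup]
    exact sInf_le ⟨κ, hstrat, rfl⟩
  · refine le_sInf ?_
    rintro _ ⟨κ', hκ', rfl⟩
    exact le_supply_of_potential hκ' hFm hgm hgint hℓint hexp hℓe
  -- In the dual value the terms `βᵀ P⁻¹ β / 2` of `g β` and `ℓ α` cancel, and the mean part that is
  -- left is the weighted norm of `β - A^t α`.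
  · have hgβ : g β = (1 / 2) * (β.ofLp ⬝ᵥ (Γ⁻¹ *ᵥ β.ofLp)) + (1 / 2) * (β.ofLp ⬝ᵥ (P⁻¹ *ᵥ β.ofLp))
        - β.ofLp ⬝ᵥ (Γ⁻¹ *ᵥ (D *ᵥ α.ofLp)) := by
      simp only [hg, hh]
      rw [sub_mulVec, dotProduct_sub, sub_dotProduct, dotProduct_comm (P⁻¹ *ᵥ β.ofLp),
        dotProduct_comm (N *ᵥ α.ofLp), hN, ← mulVec_mulVec]
      ring
    have hℓα : ℓ α = (1 / 2) * (Real.log P.det - Real.log Γ.det) +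
        (1 / 2) * (β.ofLp ⬝ᵥ (P⁻¹ *ᵥ β.ofLp)) -
          (1 / 2) * ((D *ᵥ α.ofLp) ⬝ᵥ (Γ⁻¹ *ᵥ (D *ᵥ α.ofLp))) := by
      rw [hlogZ, hNα, mulVec_mulVec, Matrix.mul_nonsing_inv _ hPu, one_mulVec,
        dotProduct_comm (P⁻¹ *ᵥ β.ofLp)]
      ring
    have hw : weightedNormSq Γ⁻¹ (β.ofLp - D *ᵥ α.ofLp) = β.ofLp ⬝ᵥ (Γ⁻¹ *ᵥ β.ofLp) -
        2 * (β.ofLp ⬝ᵥ (Γ⁻¹ *ᵥ (D *ᵥ α.ofLp))) +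
          (D *ᵥ α.ofLp) ⬝ᵥ (Γ⁻¹ *ᵥ (D *ᵥ α.ofLp)) := by
      rw [weightedNormSq]
      simp only [mulVec_sub, dotProduct_sub, sub_dotProduct]
      rw [dotProduct_mulVec_comm_of_isSymm hΓt (D *ᵥ α.ofLp) β.ofLp]
      ring
    have ht1 : trace (P⁻¹ * Θ) = trace (1 + Γ⁻¹ * (D * S * Dᵀ) * Γ⁻¹ * P) := by
      rw [hPΘ, Matrix.mul_add, Matrix.nonsing_inv_mul _ hPu]
      simp only [Matrix.mul_assoc]
      rw [Matrix.nonsing_inv_mul_cancel_left _ _ hPu]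
    have ht2 : trace (Nᵀ * P * N * S) = trace (Γ⁻¹ * (D * S * Dᵀ) * Γ⁻¹ * P) := by
      rw [hN, transpose_mul, hΓt,
        show Dᵀ * Γ⁻¹ * P * (Γ⁻¹ * D) * S = (Dᵀ * Γ⁻¹ * P) * (Γ⁻¹ * D * S) by
          simp only [Matrix.mul_assoc], trace_mul_comm]
      simp only [Matrix.mul_assoc]
    have ht3 : trace (Dᵀ * Γ⁻¹ * D * S) = trace (Γ⁻¹ * (D * S * Dᵀ)) := by
      rw [Matrix.mul_assoc, Matrix.mul_assoc, trace_mul_comm]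
      simp only [Matrix.mul_assoc]
    rw [hgval, hℓval, hgβ, hℓα, hw, hM]
    simp only [Matrix.smul_mul, Matrix.sub_mul, trace_smul, trace_sub, trace_add, smul_eq_mul,
      ht1, ht2, ht3]
    ring

end Gaussian

end NoiseSupply

/-! ### Main theorem: passage to coordinates whitened by `Γ_t^{-1/2}` -/

theorem theorem9p2 {n m : ℕ} (A : Matrix (Fin n) (Fin n) ℝ) (B : Matrix (Fin n) (Fin m) ℝ)
    (hA : NoiseSupply.IsAsymptoticallyStable A) (hAB : NoiseSupply.IsReachable A B)
    (t : ℕ) (ht : n ≤ t)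
    (α β : EuclideanSpace ℝ (Fin n)) (S Θ : Matrix (Fin n) (Fin n) ℝ)
    (hS : S.PosDef) (hΘ : Θ.PosDef) :
    (NoiseSupply.gramian A B t).PosDef ∧
    (NoiseSupply.matU A B t S).PosSemidef ∧
    (NoiseSupply.matV A B t Θ).PosDef ∧
    NoiseSupply.IsPrincipalSqrt
      (1 + (4 : ℝ) • (NoiseSupply.matU A B t S * NoiseSupply.matV A B t Θ))
      (NoiseSupply.principalSqrt
        (1 + (4 : ℝ) • (NoiseSupply.matU A B t S * NoiseSupply.matV A B t Θ))) ∧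
    (∃ G : Matrix (Fin n) (Fin n) ℝ, G.PosDef ∧
      G + G * NoiseSupply.matU A B t S * G = NoiseSupply.matV A B t Θ) ∧
    ∀ G : Matrix (Fin n) (Fin n) ℝ, G.PosDef →
      G + G * NoiseSupply.matU A B t S * G = NoiseSupply.matV A B t Θ →
      ((NoiseSupply.minSupply (NoiseSupply.linearStep A B) (multivariateGaussian 0 1) t
          (multivariateGaussian α S) (multivariateGaussian β Θ) : ℝ≥0∞) : EReal) =
        (((NoiseSupply.weightedNormSq (NoiseSupply.gramian A B t)⁻¹
              (β.ofLp - A ^ t *ᵥ α.ofLp) +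
            Matrix.trace (NoiseSupply.matU A B t S + NoiseSupply.matV A B t Θ -
              NoiseSupply.principalSqrt
                (1 + (4 : ℝ) • (NoiseSupply.matU A B t S * NoiseSupply.matV A B t Θ))) -
            Real.log G.det) / 2 : ℝ) : EReal) := by
  have hΓ := NoiseSupply.posDef_gramian hAB ht
  obtain ⟨hKpd, hKt, hKK⟩ := NoiseSupply.posDef_sqrt_and_mul_self hΓ
  have hKu : IsUnit (CFC.sqrt (NoiseSupply.gramian A B t)).det := hKpd.det_pos.ne'.isUnit
  set Γ := NoiseSupply.gramian A B t with hΓdef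
  set K := CFC.sqrt Γ with hKdef
  have hTt : K⁻¹ᵀ = K⁻¹ := NoiseSupply.posDef_transpose_eq hKpd.inv
  have hTT : K⁻¹ * K⁻¹ = Γ⁻¹ := by rw [← hKK, Matrix.mul_inv_rev]
  set D := A ^ t with hD
  have hUdef : NoiseSupply.matU A B t S = K⁻¹ * D * S * Dᵀ * K⁻¹ := rfl
  have hVdef : NoiseSupply.matV A B t Θ = K⁻¹ * Θ * K⁻¹ := rfl
  set U := NoiseSupply.matU A B t S
  set V := NoiseSupply.matV A B t Θ
  have hU : U.PosSemidef := by
    have h := hS.posSemidef.mul_mul_conjTranspose_same (K⁻¹ * D)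
    rw [conjTranspose_eq_transpose_of_trivial, transpose_mul, hTt] at h
    rw [hUdef]
    simpa only [Matrix.mul_assoc] using h
  have hV : V.PosDef := by
    have h := hΘ.mul_mul_conjTranspose_same (B := K⁻¹)
      (vecMul_injective_iff_isUnit.2 ((isUnit_iff_isUnit_det _).2 (isUnit_nonsing_inv_det _ hKu)))
    rwa [conjTranspose_eq_transpose_of_trivial, hTt] at h
  have hex := NoiseSupply.exists_posDef_quadratic hU hV
  have hsqrt : ∀ G : Matrix (Fin n) (Fin n) ℝ, G.PosDef → G + G * U * G = V →
      NoiseSupply.IsPrincipalSqrt (1 + (4 : ℝ) • (U * V)) (1 + (2 : ℝ) • (U * G)) :=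
    fun G hG h => NoiseSupply.isPrincipalSqrt_of_quadratic hU hG h
  refine ⟨hΓ, hU, hV, ?_, hex, fun G hG hGV => ?_⟩
  · obtain ⟨G, hG, hGV⟩ := hex
    rw [(hsqrt G hG hGV).eq]
    exact hsqrt G hG hGV
  rw [(hsqrt G hG hGV).eq]
  -- `K G K` undoes the whitening: it is the covariance of the terminal state given the initial
  -- state under the optimal strategy.
  have hP : (K * G * K).PosDef := by
    have h := hG.mul_mul_conjTranspose_same (B := K)
      (vecMul_injective_iff_isUnit.2 ((isUnit_iff_isUnit_det _).2 hKu))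
    rwa [conjTranspose_eq_transpose_of_trivial, hKt] at h
  have c1 (X : Matrix (Fin n) (Fin n) ℝ) : K * (K⁻¹ * X) = X :=
    Matrix.mul_nonsing_inv_cancel_left _ _ hKu
  have c2 (X : Matrix (Fin n) (Fin n) ℝ) : K⁻¹ * (K * X) = X :=
    Matrix.nonsing_inv_mul_cancel_left _ _ hKu
  have hPΘ : Θ = K * G * K + K * G * K * (Γ⁻¹ * (D * S * Dᵀ) * Γ⁻¹) * (K * G * K) := by
    calc Θ = K * V * K := by
          rw [hVdef]
          simp only [Matrix.mul_assoc, c1, Matrix.nonsing_inv_mul _ hKu, Matrix.mul_one]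
      _ = _ := by
          rw [← hGV, hUdef, ← hTT]
          simp only [Matrix.mul_assoc, Matrix.mul_add, Matrix.add_mul, c1, c2]
  obtain ⟨r, hr, hmin, hreq⟩ :=
    NoiseSupply.minSupply_multivariateGaussian hΓ α β hS.posSemidef hΘ.posSemidef hP hPΘ
  have t1 : trace (Γ⁻¹ * Θ) = trace V := by
    rw [hVdef, trace_mul_comm (K⁻¹ * Θ), ← Matrix.mul_assoc, hTT]
  have t2 : trace (Γ⁻¹ * (D * S * Dᵀ)) = trace U := by
    rw [hUdef, trace_mul_comm _ K⁻¹, ← hTT]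
    simp only [Matrix.mul_assoc]
  have t3 : trace (Γ⁻¹ * (D * S * Dᵀ) * Γ⁻¹ * (K * G * K)) = trace (U * G) := by
    rw [trace_mul_comm _ (K * G * K), hUdef, trace_mul_comm _ G, ← hTT]
    rw [show K * G * K * (K⁻¹ * K⁻¹ * (D * S * Dᵀ) * (K⁻¹ * K⁻¹)) =
      K * (G * (K⁻¹ * D * S * Dᵀ * K⁻¹) * K⁻¹) by simp only [Matrix.mul_assoc, c1],
      trace_mul_comm, Matrix.mul_assoc, Matrix.nonsing_inv_mul _ hKu, Matrix.mul_one]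
  have hdet : Real.log (K * G * K).det - Real.log Γ.det = Real.log G.det := by
    rw [← hKK, det_mul, det_mul, det_mul, mul_right_comm,
      Real.log_mul (mul_pos hKpd.det_pos hKpd.det_pos).ne' hG.det_pos.ne']
    ring
  rw [← hΓdef, ← hD] at hreq
  -- Since `0 ≤ r`, `ENNReal.ofReal` does not truncate, so the identity holds in `EReal` with a real
  -- right-hand side and includes finiteness.
  rw [hmin, EReal.coe_ennreal_ofReal, max_eq_left hr, hreq, hdet]
  congr 2
  simp only [trace_add, trace_sub, trace_smul, t1, t2, t3]
  ring
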